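/- Let $A$ be a simple unital $C^*$-algebra, $P\subset A$ a unital $C^*$-subalgebra (with the same unit), and $E:A\to P$ a faithful conditional expectation of index-finite type, i.e. there are $u_1,v_1,\dots,u_n,v_n\in A$ with $x=\sum_j u_jE(v_jx)=\sum_j E(xu_j)v_j$ for all $x\in A$; put $\mathrm{Index}\,E=\sum_j u_jv_j\in A$ (this does not depend on the choice of the $u_j,v_j$). For a normed algebra $B$ let $B_\infty=\ell^\infty(\mathbb N,B)/c_0(\mathbb N,B)$, with $B\subset B_\infty$ as constant sequences; write $E_\infty:A_\infty\to P_\infty\subset A_\infty$ for the map induced by $E$. For elements $a,b$ of a $C^*$-algebra $B$ write $a\lesssim b$ if $x_nbx_n^*\to a$ for some sequence $(x_n)$ in $B$. Let $C^*\langle A,e_P\rangle=\{\sum_i x_ie_Py_i : x_i,y_i\in A\}$ be the basic construction of $E$, where $A$ acts by left multiplication on the completion of $A$ in the norm $\|x\|_E=\|E(x^*x)\|^{1/2}$ and $e_P$ is the Jones projection on it, given by $x\mapsto E(x)$. For $z\in A_\infty$ positive and nonzero, a Rokhlin contraction for $z$ is a nonzero positive contraction $e\in A_\infty\cap A'$ such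 that $(\mathrm{Index}\,E)\,e^{1/2}e_Pe^{1/2}=e$ in $C^*\langle A,e_P\rangle_\infty$ and $1-(\mathrm{Index}\,E)E_\infty(e)\lesssim z$ in $A_\infty$. Suppose that $E$ has the generalized tracial Rokhlin property, i.e. for every nonzero positive $z\in A_\infty$ there is a Rokhlin contraction for $z$. Then for every nonzero positive $z\in A_\infty$ there are a Rokhlin contraction $e$ for $z$ and an injective completely positive map $\beta:A\to P_\infty$ of order zero (for positive $a,b\in A$ with $ab=ba=0$ one has $\beta(a)\beta(b)=\beta(b)\beta(a)=0$) such that 1. $\beta(a)=(\mathrm{Index}\,E)E_\infty(ae)$ for all $a\in A$; in particular $\beta(1)=(\mathrm{Index}\,E)E_\infty(e)$; 2. $1-\beta(1)\lesssim z$ in $A_\infty$; 3. $\beta(p)=p\,\beta(1)$ for all $p\in P$. -/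

import Mathlib

open Filter Topology
open scoped BoundedContinuousFunction

noncomputable section

/-! ### The sequence algebra `R_∞ = ℓ^∞(ℕ, R) / c₀(ℕ, R)` -/

/-- The two-sided ideal `c₀(ℕ, R)` of the sequences converging to zero inside `ℓ^∞(ℕ, R)`.
Since `ℕ` is discrete, `ℕ →ᵇ R` is the algebra of all bounded sequences. -/
def cZero (R : Type*) [NormedRing R] : Ideal (ℕ →ᵇ R) where
  carrier := {f | Tendsto (fun n => f n) atTop (𝓝 0)}
  zero_mem' := by simp
  add_mem' {f g} hf hg := by simpa using Tendsto.add hf hg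
  smul_mem' f g hg := by
    refine squeeze_zero_norm (a := fun n => ‖f‖ * ‖g n‖) (fun n => ?_) ?_
    · exact (norm_mul_le (f n) (g n)).trans
        (mul_le_mul_of_nonneg_right (f.norm_coe_le_norm n) (norm_nonneg _))
    · simpa using (Tendsto.norm hg).const_mul ‖f‖

lemma mem_cZero {R : Type*} [NormedRing R] {f : ℕ →ᵇ R} :
    f ∈ cZero R ↔ Tendsto (fun n => f n) atTop (𝓝 0) := Iff.rfl

instance cZero.isTwoSided (R : Type*) [NormedRing R] : (cZero R).IsTwoSided where
  mul_mem_of_left {f} g hf := by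
    rw [mem_cZero] at hf ⊢
    refine squeeze_zero_norm (a := fun n => ‖f n‖ * ‖g‖) (fun n => ?_) ?_
    · exact (norm_mul_le (f n) (g n)).trans
        (mul_le_mul_of_nonneg_left (g.norm_coe_le_norm n) (norm_nonneg _))
    · simpa using (Tendsto.norm hf).mul_const ‖g‖

instance cZero.isClosed (R : Type*) [NormedRing R] : IsClosed (cZero R : Set (ℕ →ᵇ R)) := by
  refine isClosed_of_closure_subset fun f hf => ?_
  rw [SetLike.mem_coe, mem_cZero, Metric.tendsto_atTop]
  intro ε hε
  obtain ⟨g, hg, hfg⟩ := Metric.mem_closure_iff.1 hf (ε / 2) (half_pos hε)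
  obtain ⟨N, hN⟩ := Metric.tendsto_atTop.1 (mem_cZero.1 hg) (ε / 2) (half_pos hε)
  refine ⟨N, fun n hn => ?_⟩
  calc dist (f n) 0 ≤ dist (f n) (g n) + dist (g n) 0 := dist_triangle _ _ _
    _ < ε / 2 + ε / 2 :=
      add_lt_add ((BoundedContinuousFunction.dist_coe_le_dist n).trans_lt hfg) (hN n hn)
    _ = ε := add_halves ε

/-- The sequence algebra `R_∞ = ℓ^∞(ℕ, R) / c₀(ℕ, R)`. -/
def SeqAlg (R : Type*) [NormedRing R] : Type _ := (ℕ →ᵇ R) ⧸ cZero R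

namespace SeqAlg

section Ring

variable {R : Type*} [NormedRing R]

instance : Ring (SeqAlg R) := inferInstanceAs (Ring ((ℕ →ᵇ R) ⧸ cZero R))

/-- The class in `R_∞` of a bounded sequence. -/
def mk : (ℕ →ᵇ R) →+* SeqAlg R := Ideal.Quotient.mk (cZero R)

lemma mk_surjective : Function.Surjective (mk : (ℕ →ᵇ R) → SeqAlg R) :=
  Ideal.Quotient.mk_surjective

lemma mk_eq_mk {f g : ℕ →ᵇ R} :
    mk f = mk g ↔ Tendsto (fun n => f n - g n) atTop (𝓝 0) :=
  Ideal.Quotient.eq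

/-- The quotient norm. -/
instance : NormedAddCommGroup (SeqAlg R) :=
  inferInstanceAs (NormedAddCommGroup ((ℕ →ᵇ R) ⧸ cZero R))

lemma eventually_lt_of_norm_lt {f : ℕ →ᵇ R} {r : ℝ} (h : ‖mk f‖ < r) :
    ∀ᶠ n in atTop, ‖f n‖ < r := by
  obtain ⟨g, hg, hgn⟩ := Submodule.Quotient.norm_mk_lt (S := cZero R)
    (Submodule.Quotient.mk f) (ε := (r - ‖mk f‖) / 2) (by linarith)
  have hgn' : ‖g‖ < ‖mk f‖ + (r - ‖mk f‖) / 2 := hgn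
  have h0 : Tendsto (fun n => f n - g n) atTop (𝓝 0) := mk_eq_mk.1 hg.symm
  filter_upwards [(Metric.tendsto_nhds.1 h0) ((r - ‖mk f‖) / 2) (by linarith)] with n hn
  rw [dist_zero_right] at hn
  calc ‖f n‖ = ‖(f n - g n) + g n‖ := by simp
    _ ≤ ‖f n - g n‖ + ‖g n‖ := norm_add_le _ _
    _ ≤ ‖f n - g n‖ + ‖g‖ := by gcongr; exact g.norm_coe_le_norm n
    _ < r := by linarith

lemma norm_mk_le_of_eventually {f : ℕ →ᵇ R} {r : ℝ} (hr : 0 ≤ r)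
    (h : ∀ᶠ n in atTop, ‖f n‖ ≤ r) : ‖mk f‖ ≤ r := by
  classical
  obtain ⟨N, hN⟩ := eventually_atTop.1 h
  have hb : ∀ n, ‖(if n < N then 0 else f n : R)‖ ≤ r := fun n => by
    split_ifs with hn
    · simpa using hr
    · exact hN n (not_lt.1 hn)
  let g : ℕ →ᵇ R := BoundedContinuousFunction.ofNormedAddCommGroupDiscrete
    (fun n => if n < N then 0 else f n) r hb
  have hfg : mk f = mk g := by
    rw [mk_eq_mk]
    refine tendsto_const_nhds.congr' ?_
    filter_upwards [eventually_ge_atTop N] with n hn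
    simp [g, not_lt.2 hn]
  rw [hfg]
  exact (Submodule.Quotient.norm_mk_le (cZero R) g).trans
    (BoundedContinuousFunction.norm_le hr |>.2 hb)

instance : NormedRing (SeqAlg R) where
  __ := (inferInstance : Ring (SeqAlg R))
  __ := (inferInstance : NormedAddCommGroup (SeqAlg R))
  norm_mul_le x y := by
    obtain ⟨f, rfl⟩ := mk_surjective x
    obtain ⟨g, rfl⟩ := mk_surjective y
    refine le_of_forall_pos_lt_add fun ε hε => ?_
    have hc : ContinuousWithinAt (fun δ : ℝ => (‖mk f‖ + δ) * (‖mk g‖ + δ)) (Set.Ioi 0) 0 := by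
      fun_prop
    have h1 : ∀ᶠ δ : ℝ in 𝓝[>] 0, (‖mk f‖ + δ) * (‖mk g‖ + δ) < ‖mk f‖ * ‖mk g‖ + ε :=
      hc.eventually (gt_mem_nhds (by simpa using hε))
    obtain ⟨δ, hδ, hδ0⟩ := (h1.and self_mem_nhdsWithin).exists
    replace hδ0 : 0 < δ := hδ0
    refine lt_of_le_of_lt ?_ hδ
    rw [← map_mul]
    refine norm_mk_le_of_eventually (by positivity) ?_
    filter_upwards [eventually_lt_of_norm_lt (f := f) (r := ‖mk f‖ + δ) (by linarith),
      eventually_lt_of_norm_lt (f := g) (r := ‖mk g‖ + δ) (by linarith)] with n hf hg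
    calc ‖(f * g) n‖ ≤ ‖f n‖ * ‖g n‖ := norm_mul_le _ _
      _ ≤ _ := by gcongr

end Ring

section Algebra

variable {R S : Type*} [NormedRing R] [NormedAlgebra ℂ R] [NormedRing S] [NormedAlgebra ℂ S]

instance : Algebra ℂ (SeqAlg R) := inferInstanceAs (Algebra ℂ ((ℕ →ᵇ R) ⧸ cZero R))

lemma mk_smul (c : ℂ) (f : ℕ →ᵇ R) : mk (c • f) = c • mk f := rfl

instance : NormedAlgebra ℂ (SeqAlg R) where
  norm_smul_le c x := by
    obtain ⟨f, rfl⟩ := mk_surjective x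
    rcases eq_or_ne c 0 with rfl | hc
    · simp
    refine le_of_forall_gt_imp_ge_of_dense fun r hr => ?_
    have hc' : 0 < ‖c‖ := norm_pos_iff.2 hc
    have h1 : ‖mk f‖ < r / ‖c‖ := by rwa [lt_div_iff₀ hc', mul_comm]
    rw [← mk_smul]
    refine norm_mk_le_of_eventually ((by positivity : (0 : ℝ) ≤ ‖c‖ * ‖mk f‖).trans hr.le) ?_
    filter_upwards [eventually_lt_of_norm_lt h1] with n hn
    have h2 : (c • f) n = c • f n := rfl
    rw [h2, norm_smul]
    rw [lt_div_iff₀ hc', mul_comm] at hn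
    exact hn.le

/-- The embedding of `R` into `R_∞` by constant sequences. -/
def const : R →ₐ[ℂ] SeqAlg R where
  toFun a := mk (BoundedContinuousFunction.const ℕ a)
  map_one' := map_one mk
  map_mul' a b := map_mul mk (BoundedContinuousFunction.const ℕ a)
    (BoundedContinuousFunction.const ℕ b)
  map_zero' := map_zero mk
  map_add' a b := map_add mk (BoundedContinuousFunction.const ℕ a)
    (BoundedContinuousFunction.const ℕ b)
  commutes' _ := rfl

/-- The linear map `T_∞ : R_∞ → S_∞`, `[(a_n)] ↦ [(T a_n)]`, induced by a bounded linear map `T`. -/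
def map (T : R →L[ℂ] S) : SeqAlg R →ₗ[ℂ] SeqAlg S where
  toFun := Quotient.map' (s₁ := (Submodule.quotientRel (cZero R)))
    (s₂ := (Submodule.quotientRel (cZero S))) (T.compLeftContinuousBounded ℕ) (by
      intro f g hfg
      rw [Submodule.quotientRel_def] at hfg ⊢
      rw [← map_sub, mem_cZero]
      simpa [Function.comp_def] using (T.continuous.tendsto 0).comp (mem_cZero.1 hfg))
  map_add' x y := by
    obtain ⟨f, rfl⟩ := mk_surjective x
    obtain ⟨g, rfl⟩ := mk_surjective y
    exact congrArg mk (map_add (T.compLeftContinuousBounded ℕ) f g)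
  map_smul' c x := by
    obtain ⟨f, rfl⟩ := mk_surjective x
    exact congrArg mk (map_smul (T.compLeftContinuousBounded ℕ) c f)

lemma map_mk (T : R →L[ℂ] S) (f : ℕ →ᵇ R) :
    map T (mk f) = mk (T.compLeftContinuousBounded ℕ f) := rfl

end Algebra

section CStar

variable {A : Type*} [CStarAlgebra A]

instance : StarRing (SeqAlg A) where
  star := Quotient.map' (s₁ := (Submodule.quotientRel (cZero A)))
    (s₂ := (Submodule.quotientRel (cZero A))) star (by
      intro f g hfg
      rw [Submodule.quotientRel_def] at hfg ⊢
      rw [← star_sub, mem_cZero]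
      simpa [Function.comp_def] using (continuous_star.tendsto (0 : A)).comp (mem_cZero.1 hfg))
  star_involutive x := by
    obtain ⟨f, rfl⟩ := mk_surjective x
    exact congrArg mk (star_star f)
  star_mul x y := by
    obtain ⟨f, rfl⟩ := mk_surjective x
    obtain ⟨g, rfl⟩ := mk_surjective y
    exact congrArg mk (star_mul f g)
  star_add x y := by
    obtain ⟨f, rfl⟩ := mk_surjective x
    obtain ⟨g, rfl⟩ := mk_surjective y
    exact congrArg mk (star_add f g)

lemma star_mk (f : ℕ →ᵇ A) : star (mk f) = mk (star f) := rfl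

instance : CStarAlgebra (SeqAlg A) where
  __ := (inferInstance : NormedRing (SeqAlg A))
  __ := (inferInstance : NormedAlgebra ℂ (SeqAlg A))
  __ := (inferInstance : StarRing (SeqAlg A))
  toCompleteSpace := inferInstanceAs (CompleteSpace ((ℕ →ᵇ A) ⧸ cZero A))
  norm_mul_self_le x := by
    obtain ⟨f, rfl⟩ := mk_surjective x
    refine le_of_forall_gt_imp_ge_of_dense fun r hr => ?_
    have hr0 : 0 ≤ r := (norm_nonneg _).trans hr.le
    rw [star_mk, ← map_mul] at hr
    have h1 : ‖mk f‖ ≤ √r := by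
      refine norm_mk_le_of_eventually (Real.sqrt_nonneg r) ?_
      filter_upwards [eventually_lt_of_norm_lt hr] with n hn
      have h2 : (star f * f) n = star (f n) * f n := rfl
      rw [h2, CStarRing.norm_star_mul_self] at hn
      exact Real.le_sqrt_of_sq_le (by rw [sq]; exact hn.le)
    calc ‖mk f‖ * ‖mk f‖ ≤ √r * √r := by gcongr
      _ = r := Real.mul_self_sqrt hr0
  star_smul c x := by
    obtain ⟨f, rfl⟩ := mk_surjective x
    exact congrArg mk (star_smul c f)

/-- The canonical order of the C⋆-algebra `A_∞`. -/
instance : PartialOrder (SeqAlg A) := CStarAlgebra.spectralOrder (SeqAlg A)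

instance : StarOrderedRing (SeqAlg A) := CStarAlgebra.spectralOrderedRing (SeqAlg A)

end CStar

end SeqAlg

/-! ### Inclusions of finite index -/

/-- A faithful conditional expectation `E : A → P` onto the unital C⋆-subalgebra `P` of `A`: a
faithful positive bounded linear `P`-bimodule map which is the identity on `P`. -/
structure ConditionalExpectation {A : Type*} [CStarAlgebra A] [PartialOrder A] [StarOrderedRing A]
    (P : StarSubalgebra ℂ A) extends toCLM : A →L[ℂ] P where
  map_coe : ∀ p : P, toCLM (p : A) = p
  map_coe_mul : ∀ (p : P) (x : A), toCLM (p * x) = p * toCLM x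
  map_mul_coe : ∀ (x : A) (p : P), toCLM (x * p) = toCLM x * p
  map_nonneg : ∀ x : A, 0 ≤ x → 0 ≤ (toCLM x : A)
  faithful : ∀ x : A, toCLM (star x * x) = 0 → x = 0

namespace ConditionalExpectation

variable {A : Type*} [CStarAlgebra A] [PartialOrder A] [StarOrderedRing A]
  {P : StarSubalgebra ℂ A}

instance : CoeFun (ConditionalExpectation P) (fun _ => A → P) where
  coe E := E.toCLM

/-- A quasi-basis of `E`: finitely many pairs `(u_j, v_j)` with
`x = ∑ u_j E(v_j x) = ∑ E(x u_j) v_j` for all `x`. -/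
structure QuasiBasis (E : ConditionalExpectation P) where
  /-- The number of pairs. -/
  n : ℕ
  /-- The first entries of the pairs. -/
  u : Fin n → A
  /-- The second entries of the pairs. -/
  v : Fin n → A
  left : ∀ x : A, x = ∑ j, u j * (E (v j * x) : A)
  right : ∀ x : A, x = ∑ j, (E (x * u j) : A) * v j

/-- `E` is of index-finite type: it has a quasi-basis. -/
def IndexFinite (E : ConditionalExpectation P) : Prop := Nonempty E.QuasiBasis

/-- The Watatani index `Index E = ∑ u_j v_j` of `E`, an element of `A`. -/
def index (E : ConditionalExpectation P) (hE : E.IndexFinite) : A :=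
  ∑ j, hE.some.u j * hE.some.v j

/-- The index does not depend on the quasi-basis. -/
lemma index_eq (E : ConditionalExpectation P) (hE : E.IndexFinite) (b : E.QuasiBasis) :
    E.index hE = ∑ j, b.u j * b.v j := by
  unfold index
  generalize hE.some = c
  have h1 : ∀ j, c.v j = ∑ i, (E (c.v j * b.u i) : A) * b.v i := fun j => b.right _
  have h2 : ∀ i, b.u i = ∑ j, c.u j * (E (c.v j * b.u i) : A) := fun i => c.left _
  calc ∑ j, c.u j * c.v j = ∑ j, c.u j * ∑ i, (E (c.v j * b.u i) : A) * b.v i := by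
        refine Finset.sum_congr rfl fun j _ => ?_
        rw [← h1 j]
    _ = ∑ i, (∑ j, c.u j * (E (c.v j * b.u i) : A)) * b.v i := by
        simp_rw [Finset.mul_sum, Finset.sum_mul, mul_assoc]
        exact Finset.sum_comm
    _ = ∑ i, b.u i * b.v i := by
        refine Finset.sum_congr rfl fun i _ => ?_
        rw [← h2 i]

/-! ### The Hilbert module `𝓔_E` and the basic construction -/

lemma map_star (E : ConditionalExpectation P) (x : A) : E (star x) = star (E x) := by
  have hsa : ∀ y : A, IsSelfAdjoint y → star (E y) = E y := fun y hy => by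
    have h1 : 0 ≤ (algebraMap ℝ A ‖y‖) + y := by
      have := hy.neg_algebraMap_norm_le_self
      rwa [neg_le_iff_add_nonneg'] at this
    have h2 : IsSelfAdjoint (E (algebraMap ℝ A ‖y‖ + y) : A) :=
      IsSelfAdjoint.of_nonneg (E.map_nonneg _ h1)
    have h3 : E (algebraMap ℝ A ‖y‖) = algebraMap ℂ P (‖y‖ : ℂ) :=
      E.map_coe (algebraMap ℂ P (‖y‖ : ℂ))
    have h4 : (E (algebraMap ℝ A ‖y‖ + y) : A) = algebraMap ℂ A (‖y‖ : ℂ) + E y := by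
      rw [map_add, h3]; rfl
    rw [h4, IsSelfAdjoint, star_add, ← algebraMap_star_comm, Complex.star_def,
      Complex.conj_ofReal, add_right_inj] at h2
    exact Subtype.ext h2
  conv_lhs => rw [← realPart_add_I_smul_imaginaryPart x]
  conv_rhs => rw [← realPart_add_I_smul_imaginaryPart x]
  rw [star_add, star_smul, map_add, map_smul, map_add, map_smul, star_add, star_smul,
    (realPart x).2.star_eq, (imaginaryPart x).2.star_eq, hsa _ (realPart x).2,
    hsa _ (imaginaryPart x).2]

lemma monotone (E : ConditionalExpectation P) {x y : A} (h : x ≤ y) : (E x : A) ≤ E y := by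
  have := E.map_nonneg (y - x) (sub_nonneg.2 h)
  rw [map_sub] at this
  exact sub_nonneg.1 this

lemma norm_le_of_le (E : ConditionalExpectation P) {x y : A} (hx : 0 ≤ x) (h : x ≤ y) :
    ‖E x‖ ≤ ‖E y‖ :=
  CStarAlgebra.norm_le_norm_of_nonneg_of_le (E.map_nonneg x hx) (E.monotone h)

/-- The `P`-valued Cauchy-Schwarz inequality, in norm. -/
lemma norm_sq_le (E : ConditionalExpectation P) (x y : A) :
    ‖E (star x * y)‖ ^ 2 ≤ ‖E (star x * x)‖ * ‖E (star y * y)‖ := by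
  rcases eq_or_ne (E (star x * x)) 0 with h0 | h0
  · rw [E.faithful x h0]; simp
  set t : ℝ := ‖E (star x * x)‖ with ht
  have ht0 : 0 < t := norm_pos_iff.2 h0
  set b : P := E (star x * y) with hb
  have hb' : E (star y * x) = star b := by rw [hb, ← E.map_star]; simp
  have h1 : 0 ≤ (E (star (x * b - (t : ℂ) • y) * (x * b - (t : ℂ) • y)) : A) :=
    E.map_nonneg _ (star_mul_self_nonneg _)
  have h2 : star (x * b - (t : ℂ) • y) * (x * b - (t : ℂ) • y) =
      ((star b : P) : A) * (star x * x * b) - (t : ℂ) • (((star b : P) : A) * (star x * y))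
        - (t : ℂ) • (star y * x * b) + (t : ℂ) • (t : ℂ) • (star y * y) := by
    simp only [star_sub, star_mul, star_smul, Complex.star_def, Complex.conj_ofReal,
      StarMemClass.coe_star, sub_mul, mul_sub, smul_mul_assoc, mul_smul_comm, mul_assoc, smul_sub]
    abel
  rw [h2, map_add, map_sub, map_sub, map_smul, map_smul, map_smul, map_smul, E.map_coe_mul,
    E.map_coe_mul, E.map_mul_coe, E.map_mul_coe, hb', ← hb] at h1
  have h3 : ((star b * (E (star x * x) * b) : P) : A) ≤ (t : ℂ) • (star (b : A) * b) := by
    have hsa : IsSelfAdjoint (E (star x * x) : A) :=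
      IsSelfAdjoint.of_nonneg (E.map_nonneg _ (star_mul_self_nonneg x))
    have := CStarAlgebra.star_left_conjugate_le_norm_smul (a := (b : A)) hsa
    rw [mul_assoc] at this
    exact this
  have h4 : (t : ℂ) • (star (b : A) * b) ≤ (t : ℂ) • (t : ℂ) • (E (star y * y) : A) := by
    have h5 : (0 : A) ≤ ((star b * (E (star x * x) * b) : P) : A) - (t : ℂ) • (star (b : A) * b)
        - (t : ℂ) • (star (b : A) * b) + (t : ℂ) • (t : ℂ) • (E (star y * y) : A) := h1
    have h6 := add_le_add h5 h3
    rw [← sub_nonneg] at h6 ⊢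
    refine h6.trans (le_of_eq ?_)
    abel
  have h7 : ‖(t : ℂ) • (star (b : A) * b)‖ ≤ ‖(t : ℂ) • (t : ℂ) • (E (star y * y) : A)‖ := by
    refine CStarAlgebra.norm_le_norm_of_nonneg_of_le ?_ h4
    have h8 : (t : ℂ) • (star (b : A) * b) = t • (star (b : A) * b) := rfl
    rw [h8]
    exact smul_nonneg ht0.le (star_mul_self_nonneg _)
  rw [norm_smul, norm_smul, norm_smul, CStarRing.norm_star_mul_self, Complex.norm_real,
    Real.norm_of_nonneg ht0.le] at h7
  have h8 := le_of_mul_le_mul_left h7 ht0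
  rw [sq]
  exact h8

/-- The vector space `A`, to be equipped with the norm `‖x‖ = ‖⟪x, x⟫_P‖ ^ (1 / 2)` of the
`P`-valued form `⟪x, y⟫_P = E (x⋆ y)`. -/
def PreModule (_E : ConditionalExpectation P) : Type _ := A

namespace PreModule

variable (E : ConditionalExpectation P)

instance : AddCommGroup E.PreModule := inferInstanceAs (AddCommGroup A)
instance : Module ℂ E.PreModule := inferInstanceAs (Module ℂ A)

/-- The identity of `A`, viewed as a map to the pre-Hilbert module. -/
def of : A ≃ₗ[ℂ] E.PreModule := LinearEquiv.refl ℂ A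

variable {E} in
/-- The `P`-valued inner product `⟪x, y⟫_P = E (x⋆ y)`. -/
def inner (x y : E.PreModule) : P := E (star ((of E).symm x) * (of E).symm y)

instance : Norm E.PreModule where
  norm x := √‖inner x x‖

lemma norm_of (x : A) : ‖of E x‖ = √‖E (star x * x)‖ := rfl

lemma normedSpaceCore : NormedSpace.Core ℂ E.PreModule where
  norm_nonneg _ := Real.sqrt_nonneg _
  norm_smul c x := by
    obtain ⟨x, rfl⟩ := (of E).surjective x
    rw [← map_smul, norm_of, norm_of, star_smul, smul_mul_assoc, mul_smul_comm, map_smul, map_smul,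
      norm_smul, norm_smul, norm_star, ← mul_assoc, Real.sqrt_mul (by positivity),
      Real.sqrt_mul_self (norm_nonneg c)]
  norm_eq_zero_iff x := by
    obtain ⟨x, rfl⟩ := (of E).surjective x
    rw [norm_of, Real.sqrt_eq_zero (norm_nonneg _), norm_eq_zero, LinearEquiv.map_eq_zero_iff]
    refine ⟨E.faithful x, ?_⟩
    rintro rfl
    simp
  norm_triangle x y := by
    obtain ⟨x, rfl⟩ := (of E).surjective x
    obtain ⟨y, rfl⟩ := (of E).surjective y
    rw [← map_add, norm_of, norm_of, norm_of, Real.sqrt_le_left (by positivity), add_sq,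
      Real.sq_sqrt (norm_nonneg _), Real.sq_sqrt (norm_nonneg _)]
    have h1 : ∀ a b : A, ‖E (star a * b)‖ ≤ √‖E (star a * a)‖ * √‖E (star b * b)‖ := fun a b => by
      rw [← Real.sqrt_mul (norm_nonneg _)]
      exact Real.le_sqrt_of_sq_le (E.norm_sq_le a b)
    have h2 : E (star (x + y) * (x + y)) =
        E (star x * x) + E (star x * y) + E (star y * x) + E (star y * y) := by
      rw [← map_add, ← map_add, ← map_add, star_add]
      congr 1
      noncomm_ring
    rw [h2]
    have h3 := h1 x y
    have h4 := h1 y x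
    have h5 := norm_add₃_le (a := E (star x * x) + E (star x * y)) (b := E (star y * x))
      (c := E (star y * y))
    have h6 := norm_add_le (E (star x * x)) (E (star x * y))
    linarith

instance : NormedAddCommGroup E.PreModule := NormedAddCommGroup.ofCore (normedSpaceCore E)
instance : NormedSpace ℂ E.PreModule := NormedSpace.ofCore (normedSpaceCore E)

lemma norm_of_mul_le (a x : A) : ‖of E (a * x)‖ ≤ ‖a‖ * ‖of E x‖ := by
  rw [norm_of, norm_of, Real.sqrt_le_left (by positivity), mul_pow, Real.sq_sqrt (norm_nonneg _)]
  have h1 : star (a * x) * (a * x) ≤ ((‖a‖ ^ 2 : ℝ) : ℂ) • (star x * x) := by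
    have := CStarAlgebra.star_left_conjugate_le_norm_smul (a := x) (IsSelfAdjoint.star_mul_self a)
    rw [CStarRing.norm_star_mul_self, ← sq] at this
    rw [star_mul, mul_assoc, ← mul_assoc (star a), ← mul_assoc]
    exact this
  refine (E.norm_le_of_le (star_mul_self_nonneg _) h1).trans (le_of_eq ?_)
  rw [map_smul, norm_smul, Complex.norm_real, Real.norm_of_nonneg (by positivity)]

lemma norm_of_map_le (x : A) : ‖of E (E x : A)‖ ≤ ‖of E x‖ := by
  rw [norm_of, norm_of]
  refine Real.sqrt_le_sqrt ?_
  have h1 : 0 ≤ (E (star (x - E x) * (x - E x)) : A) := E.map_nonneg _ (star_mul_self_nonneg _)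
  have h2 : E (star (x - E x) * (x - E x)) = E (star x * x) - E (star (E x : A) * (E x : A)) := by
    have h3 : E (star (E x : A) * x) = star (E x) * E x := E.map_coe_mul (star (E x)) x
    have h4 : E (star x * (E x : A)) = star (E x) * E x := by rw [E.map_mul_coe, E.map_star]
    have h5 : E (star (E x : A) * (E x : A)) = star (E x) * E x := E.map_coe (star (E x) * E x)
    rw [star_sub, sub_mul, mul_sub, mul_sub, map_sub, map_sub, map_sub, h3, h4, h5]
    abel
  rw [h2] at h1
  exact CStarAlgebra.norm_le_norm_of_nonneg_of_le (E.map_nonneg _ (star_mul_self_nonneg _))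
    (sub_nonneg.1 h1)

/-- Left multiplication by `a` on the pre-Hilbert module. -/
def mulLeft (a : A) : E.PreModule →L[ℂ] E.PreModule :=
  LinearMap.mkContinuous ((of E).toLinearMap ∘ₗ LinearMap.mulLeft ℂ a ∘ₗ (of E).symm.toLinearMap)
    ‖a‖ (fun x => norm_of_mul_le E a ((of E).symm x))

/-- The map `x ↦ E x` on the pre-Hilbert module. -/
def proj : E.PreModule →L[ℂ] E.PreModule :=
  LinearMap.mkContinuous ((of E).toLinearMap ∘ₗ P.subtype.toLinearMap ∘ₗ E.toCLM.toLinearMap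
    ∘ₗ (of E).symm.toLinearMap) 1 (fun x => by
      rw [one_mul]; exact norm_of_map_le E ((of E).symm x))

end PreModule

/-- The (Banach space underlying the) Hilbert module `𝓔_E`: the completion of `A` in the norm
`‖x‖ = ‖E (x⋆ x)‖ ^ (1 / 2)`. The norm of an adjointable operator on `𝓔_E` is its operator norm
on this Banach space. -/
def HilbertModule (E : ConditionalExpectation P) : Type _ :=
  UniformSpace.Completion E.PreModule

variable (E : ConditionalExpectation P)

instance : NormedAddCommGroup E.HilbertModule :=
  inferInstanceAs (NormedAddCommGroup (UniformSpace.Completion E.PreModule))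

instance : NormedSpace ℂ E.HilbertModule :=
  inferInstanceAs (NormedSpace ℂ (UniformSpace.Completion E.PreModule))

instance : CompleteSpace E.HilbertModule :=
  inferInstanceAs (CompleteSpace (UniformSpace.Completion E.PreModule))

/-- The canonical map `η_E : A → 𝓔_E`. -/
def eta : A →ₗ[ℂ] E.HilbertModule :=
  (UniformSpace.Completion.toComplL (𝕜 := ℂ) (E := E.PreModule)).toLinearMap ∘ₗ
    (PreModule.of E).toLinearMap

/-- The operator `λ(a)` of left multiplication by `a` on `𝓔_E`. -/
def lam (a : A) : E.HilbertModule →L[ℂ] E.HilbertModule := (PreModule.mulLeft E a).completion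

/-- The Jones projection `e_P` on `𝓔_E`. -/
def jones : E.HilbertModule →L[ℂ] E.HilbertModule := (PreModule.proj E).completion

lemma lam_eta (a x : A) : E.lam a (E.eta x) = E.eta (a * x) :=
  (PreModule.mulLeft E a).completion_apply_coe _

lemma jones_eta (x : A) : E.jones (E.eta x) = E.eta (E x : A) :=
  (PreModule.proj E).completion_apply_coe _

lemma ext_eta {S T : E.HilbertModule →L[ℂ] E.HilbertModule}
    (h : ∀ x, S (E.eta x) = T (E.eta x)) : S = T := by
  ext y
  induction y using UniformSpace.Completion.induction_on with
  | hp => exact isClosed_eq S.continuous T.continuous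
  | ih x => exact h x

lemma mul_op_apply (S T : E.HilbertModule →L[ℂ] E.HilbertModule) (y : E.HilbertModule) :
    (S * T) y = S (T y) := rfl

lemma lam_mul (a b : A) : E.lam (a * b) = E.lam a * E.lam b :=
  E.ext_eta fun x => by
    rw [mul_op_apply, lam_eta, lam_eta, lam_eta, mul_assoc]

lemma lam_one : E.lam 1 = 1 :=
  E.ext_eta fun x => by rw [lam_eta, one_mul]; rfl

lemma lam_add (a b : A) : E.lam (a + b) = E.lam a + E.lam b :=
  E.ext_eta fun x => by
    rw [add_apply, lam_eta, lam_eta, lam_eta, add_mul, map_add]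

lemma lam_smul (c : ℂ) (a : A) : E.lam (c • a) = c • E.lam a :=
  E.ext_eta fun x => by
    rw [smul_apply, lam_eta, lam_eta, smul_mul_assoc, map_smul]

lemma norm_eta (x : A) : ‖E.eta x‖ = √‖E (star x * x)‖ :=
  (UniformSpace.Completion.norm_coe (PreModule.of E x)).trans (PreModule.norm_of E x)

lemma norm_lam_le (a : A) : ‖E.lam a‖ ≤ ‖a‖ := by
  refine ContinuousLinearMap.opNorm_le_bound _ (norm_nonneg a) fun y => ?_
  induction y using UniformSpace.Completion.induction_on with
  | hp => exact isClosed_le (by fun_prop) (by fun_prop)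
  | ih x =>
    have h : ∀ x : A, ‖E.lam a (E.eta x)‖ ≤ ‖a‖ * ‖E.eta x‖ := fun x => by
      rw [lam_eta, norm_eta, norm_eta]
      exact PreModule.norm_of_mul_le E a x
    exact h x

lemma jones_mul_lam_mul_jones (a : A) :
    E.jones * E.lam a * E.jones = E.lam (E a : A) * E.jones :=
  E.ext_eta fun x => by
    simp only [mul_op_apply, jones_eta, lam_eta, E.map_mul_coe]
    rfl

lemma lam_eq_sum (b : E.QuasiBasis) (a : A) :
    E.lam a = ∑ j, E.lam (a * b.u j) * E.jones * E.lam (b.v j) :=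
  E.ext_eta fun x => by
    simp only [sum_apply, mul_op_apply, jones_eta, lam_eta]
    conv_lhs => rw [b.left x, Finset.mul_sum, map_sum]
    simp_rw [mul_assoc]

/-- The basic construction `C⋆⟨A, e_P⟩` of an expectation of index-finite type: the algebra of all
finite sums of operators `λ(x) e_P λ(y)` on `𝓔_E`, with the operator norm. -/
def basicConstruction (hE : E.IndexFinite) :
    Subalgebra ℂ (E.HilbertModule →L[ℂ] E.HilbertModule) :=
  Submodule.toSubalgebra
    (Submodule.span ℂ (Set.range fun p : A × A => E.lam p.1 * E.jones * E.lam p.2))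
    (by
      rw [← E.lam_one, E.lam_eq_sum hE.some 1]
      exact Submodule.sum_mem _ fun j _ => Submodule.subset_span ⟨(_, _), rfl⟩)
    (by
      intro S T hS hT
      have h := Submodule.mul_mem_mul hS hT
      rw [Submodule.span_mul_span] at h
      refine Submodule.span_mono ?_ h
      rintro _ ⟨_, ⟨p, rfl⟩, _, ⟨q, rfl⟩, rfl⟩
      refine ⟨(p.1 * (E (p.2 * q.1) : A), q.2), ?_⟩
      calc E.lam (p.1 * (E (p.2 * q.1) : A)) * E.jones * E.lam q.2
          = E.lam p.1 * (E.lam (E (p.2 * q.1) : A) * E.jones) * E.lam q.2 := by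
            rw [E.lam_mul, mul_assoc (E.lam p.1)]
        _ = E.lam p.1 * (E.jones * E.lam (p.2 * q.1) * E.jones) * E.lam q.2 := by
            rw [E.jones_mul_lam_mul_jones]
        _ = E.lam p.1 * E.jones * E.lam p.2 * (E.lam q.1 * E.jones * E.lam q.2) := by
            rw [E.lam_mul]; simp only [mul_assoc])

/-- The basic construction as a normed algebra. -/
def BasicConstruction (hE : E.IndexFinite) : Type _ := E.basicConstruction hE

instance (hE : E.IndexFinite) : NormedRing (E.BasicConstruction hE) :=
  inferInstanceAs (NormedRing (E.basicConstruction hE))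

instance (hE : E.IndexFinite) : NormedAlgebra ℂ (E.BasicConstruction hE) :=
  inferInstanceAs (NormedAlgebra ℂ (E.basicConstruction hE))

/-- The inclusion `λ : A → C⋆⟨A, e_P⟩`. -/
def lamB (hE : E.IndexFinite) : A →L[ℂ] E.BasicConstruction hE :=
  LinearMap.mkContinuous
    { toFun := fun a => ⟨E.lam a, by
        rw [E.lam_eq_sum hE.some a]
        exact Submodule.sum_mem _ fun j _ => Submodule.subset_span ⟨(_, _), rfl⟩⟩
      map_add' := fun a b => Subtype.ext (E.lam_add a b)
      map_smul' := fun c a => Subtype.ext (E.lam_smul c a) }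
    1 (fun a => by rw [one_mul]; exact E.norm_lam_le a)

/-- The Jones projection as an element of `C⋆⟨A, e_P⟩`. -/
def jonesB (hE : E.IndexFinite) : E.BasicConstruction hE :=
  ⟨E.jones, Submodule.subset_span ⟨(1, 1), by
    change E.lam 1 * E.jones * E.lam 1 = E.jones
    rw [E.lam_one, one_mul, mul_one]⟩⟩

end ConditionalExpectation

/-! ### The generalized tracial Rokhlin property and order zero maps -/

/-- A unital C⋆-algebra is simple if it is nonzero and has no closed two-sided ideals besides
`0` and itself. -/
def IsSimpleCStar (A : Type*) [CStarAlgebra A] : Prop :=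
  Nontrivial A ∧ ∀ I : TwoSidedIdeal A, IsClosed (I : Set A) → I = ⊥ ∨ I = ⊤

/-- Cuntz subequivalence `a ≲ b`: there is a sequence `(x_n)` with `x_n b x_n⋆ → a`. -/
def CuntzLE {A : Type*} [CStarAlgebra A] (a b : A) : Prop :=
  ∃ x : ℕ → A, Tendsto (fun n => x n * b * star (x n)) atTop (𝓝 a)

/-- A completely positive map has order zero if it preserves orthogonality of positive elements. -/
def CompletelyPositiveMap.IsOrderZero {A B : Type*} [CStarAlgebra A] [PartialOrder A]
    [StarOrderedRing A] [CStarAlgebra B] [PartialOrder B] [StarOrderedRing B]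
    (φ : CompletelyPositiveMap A B) : Prop :=
  ∀ a b : A, 0 ≤ a → 0 ≤ b → a * b = 0 → b * a = 0 → φ a * φ b = 0 ∧ φ b * φ a = 0

namespace ConditionalExpectation

variable {A : Type*} [CStarAlgebra A] [PartialOrder A] [StarOrderedRing A]
  {P : StarSubalgebra ℂ A}

/-- The inclusion `P_∞ → A_∞`. -/
def seqIncl (P : StarSubalgebra ℂ A) : SeqAlg P →ₗ[ℂ] SeqAlg A :=
  SeqAlg.map (Subalgebra.toSubmodule P.toSubalgebra).subtypeL

/-- The map `E_∞ : A_∞ → P_∞`. -/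
def seqMap (E : ConditionalExpectation P) : SeqAlg A →ₗ[ℂ] SeqAlg P := SeqAlg.map E.toCLM

/-- The element `(Index E) E_∞(x)` of `A_∞`. -/
def indexExp (E : ConditionalExpectation P) (hE : E.IndexFinite) (x : SeqAlg A) : SeqAlg A :=
  SeqAlg.const (E.index hE) * seqIncl P (E.seqMap x)

/-- `e` is a Rokhlin contraction for `z`: a nonzero positive contraction in `A_∞ ∩ A'` such that
`(Index E) e^{1/2} e_P e^{1/2} = e` in `C⋆⟨A, e_P⟩_∞` and `1 - (Index E) E_∞(e) ≲ z` in `A_∞`. -/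
structure IsRokhlinContraction (E : ConditionalExpectation P) (hE : E.IndexFinite)
    (e z : SeqAlg A) : Prop where
  nonneg : 0 ≤ e
  ne_zero : e ≠ 0
  norm_le_one : ‖e‖ ≤ 1
  commute : ∀ a : A, Commute (SeqAlg.const a) e
  index_mul_sqrt_mul_jones_mul_sqrt :
    SeqAlg.map (E.lamB hE) (SeqAlg.const (E.index hE)) * SeqAlg.map (E.lamB hE) (CFC.sqrt e) *
      SeqAlg.const (E.jonesB hE) * SeqAlg.map (E.lamB hE) (CFC.sqrt e) =
    SeqAlg.map (E.lamB hE) e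
  one_sub_cuntzLE : CuntzLE (1 - E.indexExp hE e) z

/-- The generalized tracial Rokhlin property of `E` (for a simple algebra `A`): every nonzero
positive element of `A_∞` admits a Rokhlin contraction. -/
def GeneralizedTracialRokhlin (E : ConditionalExpectation P) (hE : E.IndexFinite) : Prop :=
  ∀ z : SeqAlg A, 0 ≤ z → z ≠ 0 → ∃ e : SeqAlg A, E.IsRokhlinContraction hE e z

end ConditionalExpectation

end

/-! The index is central, so simplicity of $A$ makes it a scalar $l$ (`index_commute`,
`exists_eq_algebraMap`). Hence $\beta(a)=l\,E_\infty(ae)$ takes values in $P_\infty$, for any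
Rokhlin contraction $e$ that the hypothesis supplies.

Everything rests on the relation $l\,e^{1/2}e_Pe^{1/2}=e$. Finite index makes the Hilbert module
norm equivalent to the norm of $A$, so the relation can be evaluated on vectors:
$l\,e^{1/2}E_\infty(e^{1/2}x)=ex$ in $A_\infty$ (`const_mul_mul_seqMap_of_jones`). Multiplying on
the left by $y$ and applying $E_\infty$ gives
$l\,E_\infty(ye^{1/2})E_\infty(e^{1/2}x)=E_\infty(yex)$ (`smul_seqMap_mul_seqMap`).

This identity writes $\beta(a^*b)$ as the inner product of $l\,E_\infty(e^{1/2}a)$ and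
$l\,E_\infty(e^{1/2}b)$, whence complete positivity. It also gives
$\beta(a)\beta(b)=l\,E_\infty(abe^2)$, whence order zero. Injectivity follows from this product
formula, faithfulness of $E_\infty$ and simplicity; $P$-linearity is that of $E_\infty$. -/

/-! ### Simple C⋆-algebras -/

namespace IsSimpleCStar

variable {A : Type*} [CStarAlgebra A]

/-- A non-invertible central element of a simple unital C⋆-algebra vanishes. -/
lemma eq_zero_of_not_isUnit (hA : IsSimpleCStar A) {d : A} (hd : ∀ x, Commute d x)
    (hu : ¬ IsUnit d) : d = 0 := by
  let S : Set A := Set.range fun x => d * x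
  let I : TwoSidedIdeal A := TwoSidedIdeal.mk' (closure S)
    (subset_closure ⟨0, mul_zero d⟩)
    (fun hx hy => map_mem_closure₂ continuous_add hx hy (by
      rintro _ ⟨x, rfl⟩ _ ⟨y, rfl⟩
      exact ⟨x + y, mul_add d x y⟩))
    (fun hx => map_mem_closure continuous_neg hx (by
      rintro _ ⟨x, rfl⟩
      exact ⟨-x, mul_neg d x⟩))
    (fun {x y} hy => map_mem_closure (continuous_const_mul x) hy (by
      rintro _ ⟨y, rfl⟩
      exact ⟨x * y, by simp only [← mul_assoc, (hd x).eq]⟩))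
    (fun {x y} hx => map_mem_closure (f := (· * y)) (continuous_mul_const y) hx (by
      rintro _ ⟨x, rfl⟩
      exact ⟨x * y, (mul_assoc d x y).symm⟩))
  have hI : (I : Set A) = closure S := by
    ext x
    exact TwoSidedIdeal.mem_mk' ..
  rcases hA.2 I (hI ▸ isClosed_closure) with h | h
  · have : d ∈ (I : Set A) := hI ▸ subset_closure ⟨1, mul_one d⟩
    rw [h] at this
    simpa using this
  · have h1 : (1 : A) ∈ closure S := by
      rw [← hI, h]
      trivial
    -- The non-invertible elements form a closed set, so the closure of $dA$ cannot reach $1$.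
    have hS : S ⊆ nonunits A := by
      rintro _ ⟨x, rfl⟩ hx
      exact hu ((hd x).isUnit_mul_iff.1 hx).1
    exact absurd (closure_minimal hS nonunits.isClosed h1) one_notMem_nonunits

/-- The center of a simple unital C⋆-algebra consists of the scalars. -/
lemma exists_eq_algebraMap (hA : IsSimpleCStar A) {c : A} (hc : ∀ x, Commute c x) :
    ∃ l : ℂ, c = algebraMap ℂ A l := by
  have := hA.1
  obtain ⟨l, hl⟩ := spectrum.nonempty c
  -- For $l$ in the spectrum of $c$, the central element $l\cdot 1-c$ is not invertible.
  refine ⟨l, (sub_eq_zero.1 (hA.eq_zero_of_not_isUnit (fun x => ?_) hl)).symm⟩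
  exact Commute.sub_left (Algebra.commutes l x) (hc x)

end IsSimpleCStar

/-! ### Constant sequences in $A_\infty$ and annihilators -/

namespace SeqAlg

lemma continuous_const {R : Type*} [NormedRing R] [NormedAlgebra ℂ R] :
    Continuous (const : R → SeqAlg R) :=
  AddMonoidHomClass.continuous_of_bound (const : R →ₐ[ℂ] SeqAlg R) 1 fun a =>
    norm_mk_le_of_eventually (by positivity) (Eventually.of_forall fun _ => by simp)

variable {A : Type*} [CStarAlgebra A]

lemma star_sqrt (e : SeqAlg A) : star (CFC.sqrt e) = CFC.sqrt e :=
  (IsSelfAdjoint.of_nonneg (CFC.sqrt_nonneg e)).star_eq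

lemma star_const (a : A) : star (const a) = const (star a) := rfl

/-- A nonzero element of `A_∞ ∩ A'` is not annihilated by any nonzero element of a simple
algebra `A`. -/
lemma eq_zero_of_const_mul_eq_zero (hA : IsSimpleCStar A) {e : SeqAlg A} (he : e ≠ 0)
    (hc : ∀ a : A, Commute (const a) e) {a : A} (ha : const a * e = 0) : a = 0 := by
  -- The annihilator of $e$ in $A$ is a closed ideal, two-sided because $e$ commutes with $A$. It
  -- omits $1$ since $e\neq 0$, so simplicity forces it to be zero.
  let S : Set A := {x | const x * e = 0}
  let I : TwoSidedIdeal A := TwoSidedIdeal.mk' S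
    (by simp [S])
    (fun {x y} hx hy => by
      simp only [S, Set.mem_ofPred_eq] at hx hy ⊢
      rw [map_add, add_mul, hx, hy, add_zero])
    (fun {x} hx => by
      simp only [S, Set.mem_ofPred_eq] at hx ⊢
      rw [map_neg, neg_mul, hx, neg_zero])
    (fun {x y} hy => by
      simp only [S, Set.mem_ofPred_eq] at hy ⊢
      rw [map_mul, mul_assoc, hy, mul_zero])
    (fun {x y} hx => by
      simp only [S, Set.mem_ofPred_eq] at hx ⊢
      rw [map_mul, mul_assoc, (hc y).eq, ← mul_assoc, hx, zero_mul])
  have hI : (I : Set A) = S := by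
    ext x
    exact TwoSidedIdeal.mem_mk' ..
  have hS : IsClosed S :=
    isClosed_eq (continuous_const.mul _root_.continuous_const) _root_.continuous_const
  have haI : a ∈ (I : Set A) := hI ▸ ha
  rcases hA.2 I (hI ▸ hS) with h | h
  · rw [h] at haI
    simpa using haI
  · have h1 : (1 : A) ∈ S := by
      rw [← hI, h]
      trivial
    exact absurd (by simpa [S] using h1) he

end SeqAlg

namespace ConditionalExpectation

variable {A : Type*} [CStarAlgebra A] [PartialOrder A] [StarOrderedRing A]
  {P : StarSubalgebra ℂ A} (E : ConditionalExpectation P)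

/-! ### The index -/

/-- Expanding $v_jx=\sum_i E(v_jxu_i)v_i$ and then collecting $\sum_j u_jE(v_jxu_i)=xu_i$ moves $x$
from the right of the index to its left. -/
lemma index_commute (hE : E.IndexFinite) (x : A) : Commute (E.index hE) x := by
  obtain ⟨b⟩ := id hE
  rw [E.index_eq hE b, Commute, SemiconjBy]
  calc (∑ j, b.u j * b.v j) * x = ∑ j, b.u j * ∑ i, (E (b.v j * x * b.u i) : A) * b.v i := by
        rw [Finset.sum_mul]
        refine Finset.sum_congr rfl fun j _ => ?_
        rw [← b.right (b.v j * x), mul_assoc]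
    _ = ∑ i, (∑ j, b.u j * (E (b.v j * (x * b.u i)) : A)) * b.v i := by
        simp_rw [Finset.mul_sum, Finset.sum_mul, mul_assoc]
        exact Finset.sum_comm
    _ = x * ∑ i, b.u i * b.v i := by
        rw [Finset.mul_sum]
        refine Finset.sum_congr rfl fun i _ => ?_
        rw [← b.left (x * b.u i), mul_assoc]

/-- The norm of `A` is dominated by the norm of the Hilbert module if the index is finite. -/
lemma exists_norm_le_mul_norm_eta (hE : E.IndexFinite) :
    ∃ C : ℝ, 0 ≤ C ∧ ∀ x : A, ‖x‖ ≤ C * ‖E.eta x‖ := by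
  obtain ⟨b⟩ := hE
  -- The constant comes from $x=\sum_j u_jE(v_jx)$ and the Cauchy-Schwarz inequality applied to the
  -- pair $v_j^*$, $x$.
  refine ⟨∑ j, ‖b.u j‖ * ‖E.eta (star (b.v j))‖, by positivity, fun x => ?_⟩
  have h : ∀ j, ‖E (b.v j * x)‖ ≤ ‖E.eta (star (b.v j))‖ * ‖E.eta x‖ := fun j => by
    rw [norm_eta, norm_eta, ← Real.sqrt_mul (norm_nonneg _)]
    refine Real.le_sqrt_of_sq_le ?_
    simpa using E.norm_sq_le (star (b.v j)) x
  conv_lhs => rw [b.left x]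
  rw [Finset.sum_mul]
  refine norm_sum_le_of_le _ fun j _ => (norm_mul_le _ _).trans ?_
  rw [mul_assoc]
  exact mul_le_mul_of_nonneg_left (h j) (norm_nonneg _)

lemma norm_eta_le (x : A) : ‖E.eta x‖ ≤ ‖E.eta 1‖ * ‖x‖ := by
  rw [mul_comm]
  calc ‖E.eta x‖ = ‖E.lam x (E.eta 1)‖ := by rw [lam_eta, mul_one]
    _ ≤ ‖E.lam x‖ * ‖E.eta 1‖ := (E.lam x).le_opNorm _
    _ ≤ ‖x‖ * ‖E.eta 1‖ := by gcongr; exact E.norm_lam_le x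

/-- The vector on the left is $cfe_Pf-g$ applied to $\eta(x)$. The bound transfers approximate
operator identities to elements, uniformly along a bounded sequence. -/
lemma norm_eta_sub_le (hE : E.IndexFinite) (c f g x : A) :
    ‖E.eta (c * f * (E (f * x) : A) - g * x)‖ ≤
      ‖E.lamB hE c * E.lamB hE f * E.jonesB hE * E.lamB hE f - E.lamB hE g‖ *
        (‖E.eta 1‖ * ‖x‖) := by
  have h : E.eta (c * f * (E (f * x) : A) - g * x) =
      (E.lam c * E.lam f * E.jones * E.lam f - E.lam g) (E.eta x) := by
    rw [sub_apply]
    simp only [mul_op_apply, lam_eta, jones_eta, map_sub, mul_assoc]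
  rw [h]
  exact (ContinuousLinearMap.le_opNorm _ _).trans
    (mul_le_mul_of_nonneg_left (E.norm_eta_le x) (norm_nonneg _))

/-! ### The induced map `E_∞` -/

lemma seqMap_mul_seqIncl (x : SeqAlg A) (y : SeqAlg P) :
    E.seqMap (x * seqIncl P y) = E.seqMap x * y := by
  obtain ⟨f, rfl⟩ := SeqAlg.mk_surjective x
  obtain ⟨g, rfl⟩ := SeqAlg.mk_surjective y
  exact congrArg SeqAlg.mk (BoundedContinuousFunction.ext fun n => E.map_mul_coe (f n) (g n))

lemma seqMap_const_mul (p : P) (x : SeqAlg A) :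
    E.seqMap (SeqAlg.const (p : A) * x) = SeqAlg.const p * E.seqMap x := by
  obtain ⟨f, rfl⟩ := SeqAlg.mk_surjective x
  exact congrArg SeqAlg.mk (BoundedContinuousFunction.ext fun n => E.map_coe_mul p (f n))

lemma seqMap_star [IsClosed (P : Set A)] (x : SeqAlg A) :
    E.seqMap (star x) = star (E.seqMap x) := by
  obtain ⟨f, rfl⟩ := SeqAlg.mk_surjective x
  exact congrArg SeqAlg.mk (BoundedContinuousFunction.ext fun n => E.map_star (f n))

/-- The map `E_∞` is faithful if the index is finite. -/
lemma eq_zero_of_seqMap_star_mul_self (hE : E.IndexFinite) {x : SeqAlg A}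
    (hx : E.seqMap (star x * x) = 0) : x = 0 := by
  obtain ⟨C, -, hC⟩ := E.exists_norm_le_mul_norm_eta hE
  obtain ⟨f, rfl⟩ := SeqAlg.mk_surjective x
  have h0 : Tendsto (fun n => E (star (f n) * f n)) atTop (𝓝 0) := by
    simpa using SeqAlg.mk_eq_mk.1 (hx.trans (map_zero SeqAlg.mk).symm)
  rw [← map_zero SeqAlg.mk, SeqAlg.mk_eq_mk]
  -- Faithfulness of $E$ by itself gives no uniform lower bound along a sequence; the estimate
  -- $\|x\|\le C\,\|E(x^*x)\|^{1/2}$ does.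
  refine squeeze_zero_norm (a := fun n => C * ‖E.eta (f n)‖) (fun n => by simpa using hC (f n)) ?_
  simp_rw [norm_eta]
  simpa using ((h0.norm.sqrt).const_mul C)

/-- A relation `c f e_P f = g` in `C⋆⟨A, e_P⟩_∞`, evaluated on `A_∞`. -/
lemma const_mul_mul_seqMap_of_jones (hE : E.IndexFinite) (c : A) {f g : SeqAlg A}
    (h : SeqAlg.map (E.lamB hE) (SeqAlg.const c) * SeqAlg.map (E.lamB hE) f *
      SeqAlg.const (E.jonesB hE) * SeqAlg.map (E.lamB hE) f = SeqAlg.map (E.lamB hE) g)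
    (x : SeqAlg A) : SeqAlg.const c * f * seqIncl P (E.seqMap (f * x)) = g * x := by
  obtain ⟨C, hC0, hC⟩ := E.exists_norm_le_mul_norm_eta hE
  obtain ⟨F, rfl⟩ := SeqAlg.mk_surjective f
  obtain ⟨G, rfl⟩ := SeqAlg.mk_surjective g
  obtain ⟨X, rfl⟩ := SeqAlg.mk_surjective x
  -- Equality in the sequence algebra of the basic construction means that the operators differ by a
  -- null sequence in norm. Applied to the bounded vectors `X n`, they differ by a null sequence in
  -- the module norm, hence in the norm of $A$.
  have h1 : Tendsto (fun n => E.lamB hE c * E.lamB hE (F n) * E.jonesB hE *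
      E.lamB hE (F n) - E.lamB hE (G n)) atTop (𝓝 0) := by
    have h0 := SeqAlg.mk_eq_mk.1 h
    exact h0
  have h2 : ∀ n, ‖c * F n * (E (F n * X n) : A) - G n * X n‖ ≤
      C * (‖E.lamB hE c * E.lamB hE (F n) * E.jonesB hE * E.lamB hE (F n) -
        E.lamB hE (G n)‖ * (‖E.eta 1‖ * ‖X‖)) := fun n =>
    (hC _).trans (mul_le_mul_of_nonneg_left ((E.norm_eta_sub_le hE _ _ _ _).trans (by
      gcongr
      exact X.norm_coe_le_norm n)) hC0)
  have h3 : Tendsto (fun n => c * F n * (E (F n * X n) : A) - G n * X n) atTop (𝓝 0) :=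
    squeeze_zero_norm h2 (by simpa using (h1.norm.mul_const (‖E.eta 1‖ * ‖X‖)).const_mul C)
  exact SeqAlg.mk_eq_mk.2 h3

end ConditionalExpectation

/-! ### Multiplicative consequences of the Rokhlin relation -/

namespace ConditionalExpectation.IsRokhlinContraction

variable {A : Type*} [CStarAlgebra A] [PartialOrder A] [StarOrderedRing A]
  {P : StarSubalgebra ℂ A} {E : ConditionalExpectation P} {hE : E.IndexFinite} {e z : SeqAlg A}

/-- The relation `(Index E) e^{1/2} e_P e^{1/2} = e`, evaluated on `A_∞`. -/
lemma index_mul_sqrt_mul_seqMap (he : E.IsRokhlinContraction hE e z) (x : SeqAlg A) :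
    SeqAlg.const (E.index hE) * CFC.sqrt e * seqIncl P (E.seqMap (CFC.sqrt e * x)) = e * x :=
  E.const_mul_mul_seqMap_of_jones hE _ he.index_mul_sqrt_mul_jones_mul_sqrt x

variable {l : ℂ}

/-- The expectation `E_∞` intertwines products, up to the scalar index. -/
lemma smul_seqMap_mul_seqMap (he : E.IsRokhlinContraction hE e z)
    (hl : E.index hE = algebraMap ℂ A l) (x y : SeqAlg A) :
    l • (E.seqMap (x * CFC.sqrt e) * E.seqMap (CFC.sqrt e * y)) = E.seqMap (x * e * y) := by
  -- Inside $E_\infty(xey)$, replace $ey$ by $l\,e^{1/2}E_\infty(e^{1/2}y)$; the factor in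
  -- $P_\infty$ then leaves $E_\infty$ by the module property.
  rw [mul_assoc x, ← he.index_mul_sqrt_mul_seqMap y, hl, AlgHom.commutes,
    ← seqMap_mul_seqIncl, ← map_smul, Algebra.algebraMap_eq_smul_one]
  congr 1
  simp only [smul_mul_assoc, one_mul, mul_smul_comm, mul_assoc]

lemma sqrt_mul_sqrt (he : E.IsRokhlinContraction hE e z) : CFC.sqrt e * CFC.sqrt e = e :=
  CFC.sqrt_mul_sqrt_self e he.nonneg

/-- The intertwining identity at $x=ae^{1/2}$ and $y=e^{1/2}b$. The square roots are paired into $e$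
first, so only $e$ itself has to commute with $A$. -/
lemma smul_seqMap_mul_mul_seqMap (he : E.IsRokhlinContraction hE e z)
    (hl : E.index hE = algebraMap ℂ A l) (a b : A) :
    l • (E.seqMap (SeqAlg.const a * e) * E.seqMap (SeqAlg.const b * e)) =
      E.seqMap (SeqAlg.const (a * b) * (e * e)) := by
  have h := he.smul_seqMap_mul_seqMap hl (SeqAlg.const a * CFC.sqrt e)
    (CFC.sqrt e * SeqAlg.const b)
  rw [mul_assoc, ← mul_assoc (CFC.sqrt e), he.sqrt_mul_sqrt, ← (he.commute b).eq] at h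
  rw [h, map_mul SeqAlg.const]
  congr 1
  calc SeqAlg.const a * CFC.sqrt e * e * (CFC.sqrt e * SeqAlg.const b)
      = SeqAlg.const a * (CFC.sqrt e * (CFC.sqrt e * CFC.sqrt e) * CFC.sqrt e) *
          SeqAlg.const b := by rw [he.sqrt_mul_sqrt]; simp only [mul_assoc]
    _ = SeqAlg.const a * (e * (e * SeqAlg.const b)) := by
        rw [← mul_assoc (CFC.sqrt e), he.sqrt_mul_sqrt, mul_assoc e, he.sqrt_mul_sqrt]
        simp only [mul_assoc]
    _ = SeqAlg.const a * SeqAlg.const b * (e * e) := by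
        rw [← (he.commute b).eq, ← mul_assoc e, ← (he.commute b).eq]
        simp only [mul_assoc]

/-- Since $e=(e^{1/2})^*e^{1/2}$, this is faithfulness of $E_\infty$. It allows scalars to be
compared through their multiples of $E_\infty(e)$. -/
lemma seqMap_ne_zero (he : E.IsRokhlinContraction hE e z) : E.seqMap e ≠ 0 := fun h => by
  have h1 : CFC.sqrt e = 0 := E.eq_zero_of_seqMap_star_mul_self hE (by
    rw [SeqAlg.star_sqrt, he.sqrt_mul_sqrt, h])
  exact he.ne_zero (by rw [← he.sqrt_mul_sqrt, h1, mul_zero])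

/-! ### The scalar index and the order zero map; closedness of $P$ provides the involution and order
of $P_\infty$ -/

variable [IsClosed (P : Set A)]

lemma star_smul_seqMap_mul_seqMap (he : E.IsRokhlinContraction hE e z)
    (hl : E.index hE = algebraMap ℂ A l) (x y : SeqAlg A) :
    l • (star (E.seqMap (CFC.sqrt e * x)) * E.seqMap (CFC.sqrt e * y)) =
      E.seqMap (star x * e * y) := by
  rw [← seqMap_star, star_mul, SeqAlg.star_sqrt]
  exact he.smul_seqMap_mul_seqMap hl _ _

/-- A scalar index is real. -/
lemma conj_eq (he : E.IsRokhlinContraction hE e z) (hl : E.index hE = algebraMap ℂ A l) :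
    star l = l := by
  -- With $T=E_\infty(e^{1/2})$ this reads $l\,T^*T=E_\infty(e)$. The right side is self-adjoint and
  -- nonzero, so $\bar l\,T^*T=l\,T^*T$ with $T^*T\neq 0$.
  have h := he.star_smul_seqMap_mul_seqMap hl 1 1
  simp only [star_one, one_mul, mul_one] at h
  have h1 := congrArg star h
  rw [star_smul, star_mul, star_star, ← E.seqMap_star e,
    (IsSelfAdjoint.of_nonneg he.nonneg).star_eq, ← h] at h1
  refine smul_left_injective ℂ (fun h0 => he.seqMap_ne_zero ?_) h1
  rw [← h, h0, smul_zero]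

/-- The completely positive map `a ↦ (Index E) E_∞(a e)` for a scalar index. -/
noncomputable def cpMap (he : E.IsRokhlinContraction hE e z)
    (hl : E.index hE = algebraMap ℂ A l) : CompletelyPositiveMap A (SeqAlg P) where
  toLinearMap := l • E.seqMap ∘ₗ LinearMap.mulRight ℂ e ∘ₗ SeqAlg.const.toLinearMap
  map_cstarMatrix_nonneg' k M hM := by
    change 0 ≤ M.mapₗ (l • E.seqMap ∘ₗ LinearMap.mulRight ℂ e ∘ₗ SeqAlg.const.toLinearMap)
    rw [StarOrderedRing.nonneg_iff] at hM
    induction hM using AddSubmonoid.closure_induction with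
    | zero => rw [map_zero]
    | add M N _ _ hM hN => rw [map_add]; exact add_nonneg hM hN
    | mem M hM =>
    obtain ⟨N, rfl⟩ := hM
    -- The image of $N^*N$ is exactly $R^*R$: its entries carry $\bar l\,l=l\cdot l$, and the
    -- intertwining identity absorbs one factor $l$. Keeping $l$ inside $R$ avoids its square root,
    -- so $l$ need only be real.
    let R : CStarMatrix (Fin k) (Fin k) (SeqAlg P) :=
      l • N.map fun a => E.seqMap (CFC.sqrt e * SeqAlg.const a)
    refine (star_mul_self_nonneg R).trans_eq ?_
    ext i j
    change _ = l • E.seqMap (SeqAlg.const ((star N * N) i j) * e)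
    simp only [R, CStarMatrix.mul_apply, CStarMatrix.star_apply, CStarMatrix.map_apply,
      CStarMatrix.smul_apply, map_sum, Finset.sum_mul, Finset.smul_sum]
    refine Finset.sum_congr rfl fun m _ => ?_
    rw [map_mul SeqAlg.const, mul_assoc, (he.commute _).eq, ← mul_assoc, ← SeqAlg.star_const,
      ← he.star_smul_seqMap_mul_seqMap hl, star_smul, he.conj_eq hl, smul_mul_smul_comm, smul_smul]

lemma cpMap_apply (he : E.IsRokhlinContraction hE e z) (hl : E.index hE = algebraMap ℂ A l)
    (a : A) : he.cpMap hl a = l • E.seqMap (SeqAlg.const a * e) := rfl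

/-- The product depends on $a$ and $b$ only through $ab$; order zero and injectivity are both read
off from this. -/
lemma cpMap_mul_cpMap (he : E.IsRokhlinContraction hE e z)
    (hl : E.index hE = algebraMap ℂ A l) (a b : A) :
    he.cpMap hl a * he.cpMap hl b = l • E.seqMap (SeqAlg.const (a * b) * (e * e)) := by
  rw [cpMap_apply, cpMap_apply, smul_mul_smul_comm, ← smul_smul,
    he.smul_seqMap_mul_mul_seqMap hl]

lemma cpMap_isOrderZero (he : E.IsRokhlinContraction hE e z)
    (hl : E.index hE = algebraMap ℂ A l) : (he.cpMap hl).IsOrderZero := by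
  intro a b _ _ hab hba
  simp [cpMap_mul_cpMap, hab, hba]

lemma scalar_ne_zero (he : E.IsRokhlinContraction hE e z)
    (hl : E.index hE = algebraMap ℂ A l) : l ≠ 0 := by
  rintro rfl
  have h := he.star_smul_seqMap_mul_seqMap hl 1 1
  simp only [star_one, one_mul, mul_one, zero_smul] at h
  exact he.seqMap_ne_zero h.symm

/-- Since $\beta(a^*)\beta(a)=l\,E_\infty((ae)^*(ae))$ and $l\neq 0$, the vanishing of $\beta(a)$
gives $ae=0$ by faithfulness, and then $a=0$ because $e$ has no annihilator in the simple algebra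
$A$. -/
lemma cpMap_injective (hA : IsSimpleCStar A) (he : E.IsRokhlinContraction hE e z)
    (hl : E.index hE = algebraMap ℂ A l) : Function.Injective (he.cpMap hl) := by
  refine (injective_iff_map_eq_zero _).2 fun a ha => ?_
  have h1 : E.seqMap (star (SeqAlg.const a * e) * (SeqAlg.const a * e)) = 0 := by
    have h2 := he.cpMap_mul_cpMap hl (star a) a
    rw [ha, mul_zero, eq_comm, smul_eq_zero_iff_right (he.scalar_ne_zero hl)] at h2
    rw [← h2, star_mul, (IsSelfAdjoint.of_nonneg he.nonneg).star_eq, SeqAlg.star_const,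
      ← (he.commute _).eq, map_mul SeqAlg.const]
    simp only [mul_assoc]
    rw [← mul_assoc e, ← (he.commute a).eq, mul_assoc]
  exact SeqAlg.eq_zero_of_const_mul_eq_zero hA he.ne_zero he.commute
    (E.eq_zero_of_seqMap_star_mul_self hE h1)

lemma seqIncl_cpMap (he : E.IsRokhlinContraction hE e z)
    (hl : E.index hE = algebraMap ℂ A l) (a : A) :
    seqIncl P (he.cpMap hl a) = E.indexExp hE (SeqAlg.const a * e) := by
  rw [cpMap_apply, map_smul, indexExp, hl, AlgHom.commutes, Algebra.smul_def]

lemma cpMap_coe (he : E.IsRokhlinContraction hE e z)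
    (hl : E.index hE = algebraMap ℂ A l) (p : P) :
    he.cpMap hl p = SeqAlg.const p * he.cpMap hl 1 := by
  rw [cpMap_apply, cpMap_apply, map_one, one_mul, seqMap_const_mul, mul_smul_comm]

end ConditionalExpectation.IsRokhlinContraction

theorem propositionP {A : Type*} [CStarAlgebra A] [PartialOrder A] [StarOrderedRing A]
    (hA : IsSimpleCStar A) (P : StarSubalgebra ℂ A) [IsClosed (P : Set A)]
    (E : ConditionalExpectation P) (hE : E.IndexFinite) (hR : E.GeneralizedTracialRokhlin hE)
    (z : SeqAlg A) (hz : 0 ≤ z) (hz0 : z ≠ 0) :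
    ∃ e : SeqAlg A, E.IsRokhlinContraction hE e z ∧
      ∃ β : CompletelyPositiveMap A (SeqAlg P),
        β.IsOrderZero ∧ Function.Injective β ∧
        (∀ a : A, ConditionalExpectation.seqIncl P (β a) =
          E.indexExp hE (SeqAlg.const a * e)) ∧
        ConditionalExpectation.seqIncl P (β 1) = E.indexExp hE e ∧
        CuntzLE (1 - ConditionalExpectation.seqIncl P (β 1)) z ∧
        (∀ p : P, β p = SeqAlg.const p * β 1) := by
  obtain ⟨l, hl⟩ := hA.exists_eq_algebraMap (E.index_commute hE)
  obtain ⟨e, he⟩ := hR z hz hz0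
  have h1 : ConditionalExpectation.seqIncl P (he.cpMap hl 1) = E.indexExp hE e := by
    rw [he.seqIncl_cpMap hl, map_one, one_mul]
  exact ⟨e, he, he.cpMap hl, he.cpMap_isOrderZero hl, he.cpMap_injective hA hl,
    he.seqIncl_cpMap hl, h1, h1 ▸ he.one_sub_cuntzLE, he.cpMap_coe hl⟩
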